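/- **Setting.** Let $S^1=[-1,1]/(-1\sim 1)$ with Lebesgue measure $m_{S^1}$, and $T^2=S^1\times S^1$ with $m_{T^2}=m_{S^1}\times m_{S^1}$. For a map $f:M\to M$ and $x\in M$ put $\sigma_n(x)=\frac1n\sum_{j=0}^{n-1}\delta_{f^j(x)}$. The basin $B(\mu)$ of a Borel probability measure $\mu$ is the set of $x$ with $\int\varphi\,d\sigma_n(x)\to\int\varphi\,d\mu$ for every continuous $\varphi:M\to\mathbb R$. An $f$-invariant Borel probability measure $\mu$ is *physical* if $B(\mu)$ has positive Lebesgue measure. **Bowen's construction** in $[c-r,c+r]$. Take $0<b<r$ and $\alpha_n>0$ $(n\ge1)$ with $\sum_{n\ge 1}\alpha_n<2(r-b)$, $\alpha_{n+1}<\alpha_n$, $\alpha_{n+1}/\alpha_n\to1$, $\alpha_1<2b$. The gap of generation $0$ is $(c-b,c+b)$; the atoms of generation $1$ are $I_0=[c-r,c-b]$ and $I_1=[c+b,c+r]$. Inductively, the atom $I_{a_0\dots a_{n-1}}$ $(n\ge1$, $a_j\in\{0,1\})$ contains, at its centre, the open gap $I^*_{a_0\dots a_{n-1}}$ of generation $n$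 and of length $\alpha_n/2^n$, whose removal leaves the atom $I_{a_0\dots a_{n-1}0}$ on the left and the atom $I_{a_0\dots a_{n-1}1}$ on the right. Let $K$ be the Cantor set $\bigcap_{n\ge1}\bigcup_{a_0\dots a_{n-1}}I_{a_0\dots a_{n-1}}$. A *Bowen map* for these data is a continuous map $G:I_0\cup I_1\to[c-r,c+r]$ such that for all $n\ge 0$ it maps each gap $I^*_{a_0a_1\dots a_n}$ onto the gap $I^*_{a_1\dots a_n}$ (the gap of generation $0$ if $n=0$) by a $C^1$ increasing map with derivative bounded below by a constant greater than $1$; $G'\to2$ at both end points of each gap; and, for some $\epsilon_n\to0$, $|G'-2|<\epsilon_n$ on all gaps of generation $n+1$, $n\ge1$. **The map $f_1$.** Let $G$ be a Bowen map in $[-1,1]$ with gap of generation $0$ equal to $(-b,b)$ and Cantor set $K_{S^1}$. Let $G_c:[-b,b]\to[-1,1]$ be a $C^1$, increasing, surjective map with derivative bounded below by a constant greater than $1$ and equal to $2$ at $\pm b$. Let $f_1:S^1\to S^1$ be induced by $G$ on $I_0\cup I_1$ and by $G_c$ on $(-b,b)$. **The map $f_2$.** Let $k\ge1$. For $1\le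 i\le k$ let $G_i$ be a Bowen map with Cantor set $K_{i,S^1}$, where the construction is carried out in $[-1,1]$ for $i=1$ and, for $i\ge2$, in a compact interval contained in a gap (the host gap of $i$) of some $K_{j,S^1}$ with $j<i$; different $i$ have different host gaps. Let $f_2:S^1\to S^1$ be a $C^1$ orientation preserving uniformly expanding map that coincides with $G_i$ on the domain of $G_i$, for every $i$, except possibly inside those gaps of $K_{i,S^1}$ that are host gaps of later indices. Let $f(x,y)=(f_1(x),f_2(y))$ on $T^2$. Put $\mu_{K_{S^1}}(B)=\frac{m_{S^1}(B\cap K_{S^1})}{m_{S^1}(K_{S^1})}$, $\mu_{K_{i,S^1}}(B)=\frac{m_{S^1}(B\cap K_{i,S^1})}{m_{S^1}(K_{i,S^1})}$ for Borel sets $B\subset S^1$, and $\mu_{K_{i,T^2}}=\mu_{K_{S^1}}\times\mu_{K_{i,S^1}}$. **Proposition.** For every $i\in\{1,\dots,k\}$ the measure $\mu_{K_{i,T^2}}$ is physical for $f$: it is an $f$-invariant Borel probability measure on $T^2$, and $m_{T^2}(B(\mu_{K_{i,T^2}}))>0$. -/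

import Mathlib

open Set Filter Topology MeasureTheory

noncomputable section

/-! ### Empiric probabilities, basins of statistical attraction, physical measures -/

section Physical

variable {M : Type*} [TopologicalSpace M] [MeasurableSpace M]

/-- The empiric probability `(1/n) ∑_{j<n} δ_{f^j(x)}` (for `n ≥ 1`). -/
def empiricMeasure (f : M → M) (n : ℕ) (x : M) : Measure M :=
  (n : ENNReal)⁻¹ • ∑ j ∈ Finset.range n, Measure.dirac (f^[j] x)

/-- The basin of statistical attraction of `μ`: the points `x` whose empiric probabilities
converge to `μ` in the weak-star topology. -/
def statBasin (f : M → M) (μ : Measure M) : Set M :=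
  {x | ∀ φ : C(M, ℝ),
    Tendsto (fun n : ℕ => ∫ y, φ y ∂(empiricMeasure f n x)) atTop (𝓝 (∫ y, φ y ∂μ))}

/-- `μ` is a physical measure of `f` with respect to the reference (Lebesgue) measure `m`:
an `f`-invariant probability measure whose basin has positive `m`-measure. -/
structure IsPhysical (m : Measure M) (f : M → M) (μ : Measure M) : Prop where
  isProbabilityMeasure : IsProbabilityMeasure μ
  invariant : MeasurePreserving f μ μ
  basin_pos : 0 < m (statBasin f μ)

end Physical

/-! ### Bowen's Cantor sets of positive measure -/

/-- Parameters of Bowen's construction in the interval `[mid - rad, mid + rad]`: the gap of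
generation `0` is `(mid - b, mid + b)`, and each of the `2^n` gaps of generation `n ≥ 1` has
length `α n / 2^n`.  The value `α 0` is irrelevant. -/
structure BowenParam where
  mid : ℝ
  rad : ℝ
  b : ℝ
  α : ℕ → ℝ
  b_pos : 0 < b
  b_lt_rad : b < rad
  α_pos : ∀ n, 1 ≤ n → 0 < α n
  α_summable : Summable fun n => α (n + 1)
  α_tsum_lt : ∑' n, α (n + 1) < 2 * (rad - b)
  α_strictAnti : ∀ n, 1 ≤ n → α (n + 1) < α n
  α_ratio : Tendsto (fun n => α (n + 1) / α n) atTop (𝓝 1)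
  α_one_lt : α 1 < 2 * b

/-- The shift `a₀ a₁ a₂ … ↦ a₁ a₂ …`. -/
def shiftSeq (a : ℕ → Bool) : ℕ → Bool := fun n => a (n + 1)

namespace BowenParam

variable (P : BowenParam)

/-- Half of the length of the gaps of generation `n`. -/
def gapRad : ℕ → ℝ
  | 0 => P.b
  | n + 1 => P.α (n + 1) / 2 ^ (n + 1) / 2

/-- Half of the length of the atoms of generation `n` (generation `0` is the whole interval). -/
def atomRad : ℕ → ℝ
  | 0 => P.rad
  | n + 1 => (atomRad n - P.gapRad n) / 2

/-- The common centre of the atom and of the gap of generation `n` with word `a₀ … a_{n-1}`.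
Words of length `n` are given as infinite sequences of which only the first `n` terms are used;
`false` is the symbol `0` (left) and `true` is the symbol `1` (right). -/
def centre : ℕ → (ℕ → Bool) → ℝ
  | 0, _ => P.mid
  | n + 1, a =>
    if a n then centre n a + (P.gapRad n + P.atomRad (n + 1))
    else centre n a - (P.gapRad n + P.atomRad (n + 1))

/-- The atom `I_{a₀ … a_{n-1}}` of generation `n`. -/
def atom (n : ℕ) (a : ℕ → Bool) : Set ℝ :=
  Icc (P.centre n a - P.atomRad n) (P.centre n a + P.atomRad n)

/-- The gap `I*_{a₀ … a_{n-1}}` of generation `n`. -/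
def gap (n : ℕ) (a : ℕ → Bool) : Set ℝ :=
  Ioo (P.centre n a - P.gapRad n) (P.centre n a + P.gapRad n)

/-- The whole interval in which the construction takes place. -/
def interval : Set ℝ := Icc (P.mid - P.rad) (P.mid + P.rad)

/-- The union `I_0 ∪ I_1` of the two atoms of generation `1`. -/
def dom : Set ℝ :=
  Icc (P.mid - P.rad) (P.mid - P.b) ∪ Icc (P.mid + P.b) (P.mid + P.rad)

/-- The Cantor set: the intersection over `n` of the union of the atoms of generation `n`. -/
def cantor : Set ℝ := ⋂ n : ℕ, ⋃ a : ℕ → Bool, P.atom n a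

end BowenParam

/-! ### Bowen's expanding maps -/

/-- Order preserving and uniformly expanding on the open set `s`. -/
def IsExpandingOn (G : ℝ → ℝ) (s : Set ℝ) : Prop :=
  ∃ c : ℝ, 1 < c ∧ ∀ x ∈ s, c ≤ deriv G x

/-- `G` (of which only the values on `I_0 ∪ I_1` matter) is a map given by Bowen's construction:
it is continuous on `I_0 ∪ I_1`, and maps each gap `I*_{a₀ a₁ … a_n}` onto the gap
`I*_{a₁ … a_n}` by a `C¹` order preserving expanding map, with the derivative tending to `2` at
the end points of each gap, and uniformly close to `2` on the gaps of high generation. -/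
structure IsBowenMap (P : BowenParam) (G : ℝ → ℝ) : Prop where
  continuousOn : ContinuousOn G P.dom
  contDiffOn_gap : ∀ n a, ContDiffOn ℝ 1 G (P.gap (n + 1) a)
  expanding_gap : ∀ n a, IsExpandingOn G (P.gap (n + 1) a)
  image_gap : ∀ n a, G '' P.gap (n + 1) a = P.gap n (shiftSeq a)
  deriv_left : ∀ n a,
    Tendsto (deriv G) (𝓝[>] (P.centre (n + 1) a - P.gapRad (n + 1))) (𝓝 2)
  deriv_right : ∀ n a,
    Tendsto (deriv G) (𝓝[<] (P.centre (n + 1) a + P.gapRad (n + 1))) (𝓝 2)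
  deriv_near_two : ∃ ε : ℕ → ℝ, Tendsto ε atTop (𝓝 0) ∧
    ∀ n, 1 ≤ n → ∀ a, ∀ x ∈ P.gap (n + 1) a, |deriv G x - 2| < ε n

/-! ### The circle and the two families of examples on it -/

instance fact_zero_lt_two_real : Fact ((0 : ℝ) < 2) := ⟨two_pos⟩

/-- The circle `S¹ = [-1, 1] / (-1 ∼ 1) = ℝ / 2ℤ`; its `volume` is the Lebesgue measure, of total
mass `2`. -/
abbrev S1 : Type := AddCircle (2 : ℝ)

/-- The torus `T² = S¹ × S¹`; its `volume` is the product of the Lebesgue measures. -/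
abbrev T2 : Type := S1 × S1

/-- `f` is an order preserving `C¹` uniformly expanding map of the circle (in terms of a lift). -/
def IsC1ExpandingCircleMap (f : S1 → S1) : Prop :=
  ∃ F : ℝ → ℝ, ContDiff ℝ 1 F ∧ (∃ c : ℝ, 1 < c ∧ ∀ x, c ≤ deriv F x) ∧
    ∀ x : ℝ, f (x : S1) = (F x : S1)

/-- The normalized restriction `B ↦ m (B ∩ K) / m K` of Lebesgue measure to `K ⊆ S¹`. -/
def normLeb (K : Set S1) : Measure S1 := ProbabilityTheory.cond volume K

/-- The choices made in the first example on the circle: Bowen's construction in `[-1, 1]`, and a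
`C¹` expanding order preserving map `Gc` of `[-b, b]` onto `[-1, 1]` that has derivative `2` at the
end points. -/
structure FirstExample where
  P : BowenParam
  mid_eq : P.mid = 0
  rad_eq : P.rad = 1
  G : ℝ → ℝ
  isBowenMap : IsBowenMap P G
  Gc : ℝ → ℝ
  contDiffOn_Gc : ContDiffOn ℝ 1 Gc (Icc (-P.b) P.b)
  expanding_Gc : IsExpandingOn Gc (Ioo (-P.b) P.b)
  image_Gc : Gc '' Icc (-P.b) P.b = Icc (-1) 1
  deriv_Gc_left : Tendsto (deriv Gc) (𝓝[>] (-P.b)) (𝓝 2)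
  deriv_Gc_right : Tendsto (deriv Gc) (𝓝[<] P.b) (𝓝 2)

namespace FirstExample

variable (E : FirstExample)

open Classical in
/-- The map of `[-1, 1]` that is `G` on `I_0 ∪ I_1` and `Gc` on the gap `(-b, b)`. -/
def intervalMap (x : ℝ) : ℝ := if x ∈ Ioo (-E.P.b) E.P.b then E.Gc x else E.G x

/-- The induced map of the circle. -/
def map : S1 → S1 := AddCircle.liftIco 2 (-1) fun x => (E.intervalMap x : S1)

/-- The Cantor set of the first example, in the circle. -/
def cantor : Set S1 := (fun x : ℝ => (x : S1)) '' E.P.cantor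

end FirstExample

/-- The second example on the circle, with `k` Cantor sets.  The Cantor set of index `0` is given
by Bowen's construction in `[-1, 1]`.  The Cantor set of index `i ≠ 0` is given by Bowen's
construction in a compact interval inside a gap (the host gap of `i`) of one of the Cantor sets of
smaller index; different indices use different host gaps.  The map is a `C¹` expanding map of the
circle that coincides with the `i`-th Bowen map on its domain, except inside those gaps of the
`i`-th Cantor set that are host gaps of later Cantor sets, where it has been modified. -/
structure SecondExample (k : ℕ) where
  P : Fin k → BowenParam
  G : Fin k → ℝ → ℝ
  isBowenMap : ∀ i, IsBowenMap (P i) (G i)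
  mid_eq : ∀ i : Fin k, (i : ℕ) = 0 → (P i).mid = 0
  rad_eq : ∀ i : Fin k, (i : ℕ) = 0 → (P i).rad = 1
  hostIndex : Fin k → Fin k
  hostGap : Fin k → Set ℝ
  hostIndex_lt : ∀ i : Fin k, (i : ℕ) ≠ 0 → hostIndex i < i
  hostGap_isGap : ∀ i : Fin k, (i : ℕ) ≠ 0 → ∃ n a, hostGap i = (P (hostIndex i)).gap n a
  interval_subset : ∀ i : Fin k, (i : ℕ) ≠ 0 → (P i).interval ⊆ hostGap i
  hostGap_ne : ∀ i j : Fin k, (i : ℕ) ≠ 0 → (j : ℕ) ≠ 0 → i ≠ j → hostGap i ≠ hostGap j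
  map : S1 → S1
  expanding : IsC1ExpandingCircleMap map
  map_eq : ∀ i, ∀ x ∈ (P i).dom,
    (∀ j : Fin k, (j : ℕ) ≠ 0 → hostIndex j = i → x ∉ hostGap j) → map (x : S1) = (G i x : S1)

/-- The `i`-th Cantor set of the second example, in the circle. -/
def SecondExample.cantor {k : ℕ} (E : SecondExample k) (i : Fin k) : Set S1 :=
  (fun x : ℝ => (x : S1)) '' (E.P i).cantor

/-! ### The example on the torus -/

/-- `f (x, y) = (f₁ x, f₂ y)`. -/
def torusProductMap (E₁ : FirstExample) {k : ℕ} (E₂ : SecondExample k) : T2 → T2 :=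
  fun p => (E₁.map p.1, E₂.map p.2)

/-- The product of the normalized Lebesgue measures on the Cantor set of the first example and on
the `i`-th Cantor set of the second example. -/
def torusProductMeasure (E₁ : FirstExample) {k : ℕ} (E₂ : SecondExample k) (i : Fin k) : Measure T2 :=
  (normLeb E₁.cantor).prod (normLeb (E₂.cantor i))

end

/-! A point of a Bowen Cantor set is the centre of the interval plus a series of signed offsets, one
sign per letter of its itinerary, and a Bowen map acts on it as the shift
(`IsBowenMap.apply_point`). All atoms of one generation have the same length, so negating the `s`-th
letter translates each of the two halves of the Cantor set cut out by that letter. Hence normalized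
Lebesgue measure, read on itineraries, is invariant under every `flipAt s`
(`measurePreserving_flipAt`): it behaves like fair coin tossing.

For a product of two such measures every nontrivial product of Walsh functions has integral zero,
because flipping one letter negates it. Its translates under the shift are therefore uncorrelated
signs. Uncorrelated centred signs are pairwise independent, so the strong law gives the right orbit
averages almost everywhere. There are countably many Walsh products and their span is dense by
Stone-Weierstrass, so almost every pair of itineraries is generic (`ae_tendsto_average`). Invariance
follows from the existence of one generic point.

Projecting to the torus, almost every point for the product measure lies in its basin. That measure
is absolutely continuous, since the Cantor sets have positive length (`volume_cantor_pos`), so the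
basin is not Lebesgue null. -/

noncomputable section

/-- The sign `1` of `true` and `-1` of `false`. -/
def boolSign (b : Bool) : ℝ := if b then 1 else -1

@[simp] lemma boolSign_true : boolSign true = 1 := rfl

@[simp] lemma boolSign_false : boolSign false = -1 := rfl

lemma boolSign_not (b : Bool) : boolSign (!b) = -boolSign b := by cases b <;> simp

lemma boolSign_mul_self (b : Bool) : boolSign b * boolSign b = 1 := by cases b <;> simp

lemma abs_boolSign (b : Bool) : |boolSign b| = 1 := by cases b <;> simp

lemma boolSign_injective : Function.Injective boolSign := by
  intro a b h
  cases a <;> cases b <;> norm_num at h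
  all_goals rfl

/-! ### Itineraries as coordinates on the Cantor set. -/

namespace BowenParam

variable (P : BowenParam)

/-- The distance between the centre of an atom of generation `n` and the centres of the two atoms
of generation `n + 1` that it contains. -/
def offset (n : ℕ) : ℝ := P.gapRad n + P.atomRad (n + 1)

/-- The point of the Cantor set with the given itinerary. -/
def point (a : ℕ → Bool) : ℝ := P.mid + ∑' j, boolSign (a j) * P.offset j

lemma gapRad_pos (n : ℕ) : 0 < P.gapRad n := by
  cases n with
  | zero => exact P.b_pos
  | succ n =>
    have := P.α_pos (n + 1) (by omega)
    simp only [gapRad]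
    positivity

lemma two_mul_atomRad_succ (n : ℕ) : 2 * P.atomRad (n + 1) = P.atomRad n - P.gapRad n := by
  simp only [atomRad]; ring

lemma offset_eq (n : ℕ) : P.offset n = P.atomRad n - P.atomRad (n + 1) := by
  have := P.two_mul_atomRad_succ n
  unfold offset; linarith

/-- Half of the total length left after removing the gaps of generations `0` to `n`: generation `0`
takes `2b` and generation `j ≥ 1` takes `α j`. Positivity of the atoms is read off from this. -/
lemma two_pow_mul_atomRad (n : ℕ) :
    2 ^ (n + 1) * P.atomRad (n + 1) = P.rad - P.b - (∑ j ∈ Finset.range n, P.α (j + 1)) / 2 := by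
  induction n with
  | zero => simp [atomRad, gapRad]; ring
  | succ n ih =>
    have h := P.two_mul_atomRad_succ (n + 1)
    have h2 : 2 ^ (n + 1) * P.gapRad (n + 1) = P.α (n + 1) / 2 := by
      simp only [gapRad]; field_simp
    rw [Finset.sum_range_succ, pow_succ, mul_assoc, h, mul_sub, ih, h2]; ring

lemma sum_range_α_lt (n : ℕ) : ∑ j ∈ Finset.range n, P.α (j + 1) < 2 * (P.rad - P.b) :=
  (P.α_summable.sum_le_tsum _ fun i _ => (P.α_pos (i + 1) (by omega)).le).trans_lt P.α_tsum_lt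

lemma atomRad_pos (n : ℕ) : 0 < P.atomRad n := by
  cases n with
  | zero => exact P.b_pos.trans P.b_lt_rad
  | succ n =>
    have h := P.two_pow_mul_atomRad n
    have h2 := P.sum_range_α_lt n
    have : 0 < 2 ^ (n + 1) * P.atomRad (n + 1) := by linarith
    exact pos_of_mul_pos_right this (by positivity)

lemma atomRad_le (n : ℕ) : P.atomRad n ≤ P.rad * (1 / 2) ^ n := by
  induction n with
  | zero => simp [atomRad]
  | succ n ih =>
    have := P.two_mul_atomRad_succ n
    have := P.gapRad_pos n
    rw [pow_succ]; linarith

lemma gapRad_lt_atomRad (n : ℕ) : P.gapRad n < P.atomRad n := by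
  have := P.two_mul_atomRad_succ n
  have := P.atomRad_pos (n + 1)
  linarith

lemma tendsto_atomRad : Tendsto P.atomRad atTop (𝓝 0) := by
  refine squeeze_zero (fun n => (P.atomRad_pos n).le) P.atomRad_le ?_
  simpa using (tendsto_pow_atTop_nhds_zero_of_lt_one (r := (1 / 2 : ℝ))
    (by norm_num) (by norm_num)).const_mul P.rad

lemma tendsto_gapRad : Tendsto P.gapRad atTop (𝓝 0) :=
  squeeze_zero (fun n => (P.gapRad_pos n).le) (fun n => (P.gapRad_lt_atomRad n).le)
    P.tendsto_atomRad

lemma offset_pos (n : ℕ) : 0 < P.offset n := add_pos (P.gapRad_pos n) (P.atomRad_pos (n + 1))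

lemma offset_le (n : ℕ) : P.offset n ≤ P.rad * (1 / 2) ^ n := by
  have := P.offset_eq n
  have := P.atomRad_pos (n + 1)
  have := P.atomRad_le n
  linarith

lemma summable_offset : Summable P.offset :=
  Summable.of_nonneg_of_le (fun n => (P.offset_pos n).le) P.offset_le
    (summable_geometric_two.mul_left P.rad)

lemma norm_boolSign_mul_offset (b : Bool) (n : ℕ) : ‖boolSign b * P.offset n‖ ≤ P.offset n := by
  rw [Real.norm_eq_abs, abs_mul, abs_boolSign, one_mul, abs_of_pos (P.offset_pos n)]

lemma summable_boolSign_mul_offset (a : ℕ → Bool) :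
    Summable fun j => boolSign (a j) * P.offset j :=
  Summable.of_norm_bounded P.summable_offset fun j => P.norm_boolSign_mul_offset (a j) j

lemma centre_succ (n : ℕ) (a : ℕ → Bool) :
    P.centre (n + 1) a = P.centre n a + boolSign (a n) * P.offset n := by
  simp only [centre, offset]
  cases a n <;> simp
  ring

lemma centre_eq_sum (n : ℕ) (a : ℕ → Bool) :
    P.centre n a = P.mid + ∑ j ∈ Finset.range n, boolSign (a j) * P.offset j := by
  induction n with
  | zero => simp [centre]
  | succ n ih => rw [centre_succ, ih, Finset.sum_range_succ]; ring

lemma continuous_boolSign_apply (j : ℕ) : Continuous fun a : ℕ → Bool => boolSign (a j) :=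
  (continuous_of_discreteTopology (f := boolSign)).comp (continuous_apply j)

lemma continuous_centre (n : ℕ) : Continuous (P.centre n) := by
  have : P.centre n = fun a => P.mid + ∑ j ∈ Finset.range n, boolSign (a j) * P.offset j :=
    funext fun a => P.centre_eq_sum n a
  rw [this]
  exact continuous_const.add (continuous_finsetSum _ fun j _ =>
    (continuous_boolSign_apply j).mul continuous_const)

lemma continuous_point : Continuous P.point :=
  continuous_const.add (continuous_tsum
    (fun j => (continuous_boolSign_apply j).mul continuous_const) P.summable_offset
    fun j a => P.norm_boolSign_mul_offset (a j) j)

lemma tendsto_centre (a : ℕ → Bool) : Tendsto (fun n => P.centre n a) atTop (𝓝 (P.point a)) := by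
  simp only [centre_eq_sum]
  exact (P.summable_boolSign_mul_offset a).hasSum.tendsto_sum_nat.const_add _

lemma centre_congr {n : ℕ} {a b : ℕ → Bool} (h : ∀ j < n, a j = b j) :
    P.centre n a = P.centre n b := by
  rw [centre_eq_sum, centre_eq_sum]
  congr 1
  exact Finset.sum_congr rfl fun j hj => by rw [h j (Finset.mem_range.1 hj)]

lemma atom_succ_subset (n : ℕ) (a : ℕ → Bool) : P.atom (n + 1) a ⊆ P.atom n a := by
  have h := P.centre_succ n a
  have h2 := P.offset_eq n
  have h3 := P.offset_pos n
  apply Icc_subset_Icc <;> cases ha : a n <;> simp [ha] at h <;> linarith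

lemma atom_antitone (a : ℕ → Bool) : Antitone fun n => P.atom n a :=
  antitone_nat_of_succ_le fun n => P.atom_succ_subset n a

lemma atom_subset_interval (n : ℕ) (a : ℕ → Bool) : P.atom n a ⊆ P.interval :=
  P.atom_antitone a (Nat.zero_le n)

lemma centre_mem_gap (n : ℕ) (a : ℕ → Bool) : P.centre n a ∈ P.gap n a := by
  have := P.gapRad_pos n
  constructor <;> linarith

lemma gap_subset_atom (n : ℕ) (a : ℕ → Bool) : P.gap n a ⊆ P.atom n a := by
  have := P.gapRad_lt_atomRad n
  intro x hx
  exact ⟨by linarith [hx.1], by linarith [hx.2]⟩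

lemma centre_mem_atom {m n : ℕ} (h : m ≤ n) (a : ℕ → Bool) : P.centre n a ∈ P.atom m a :=
  P.atom_antitone a h (P.gap_subset_atom n a (P.centre_mem_gap n a))

lemma isClosed_atom (n : ℕ) (a : ℕ → Bool) : IsClosed (P.atom n a) := isClosed_Icc

lemma point_mem_atom (n : ℕ) (a : ℕ → Bool) : P.point a ∈ P.atom n a :=
  (P.isClosed_atom n a).mem_of_tendsto (P.tendsto_centre a)
    ((eventually_ge_atTop n).mono fun _ hm => P.centre_mem_atom hm a)

lemma le_of_mem_atom_of_true {j m : ℕ} {a : ℕ → Bool} {x : ℝ} (hx : x ∈ P.atom m a) (hj : j < m)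
    (ha : a j = true) : P.centre j a + P.gapRad j ≤ x := by
  have h := (P.atom_antitone a hj hx).1
  simp only [centre_succ, ha, boolSign_true, offset] at h
  linarith

lemma le_of_mem_atom_of_false {j m : ℕ} {a : ℕ → Bool} {x : ℝ} (hx : x ∈ P.atom m a) (hj : j < m)
    (ha : a j = false) : x ≤ P.centre j a - P.gapRad j := by
  have h := (P.atom_antitone a hj hx).2
  simp only [centre_succ, ha, boolSign_false, offset] at h
  linarith

/-- If all earlier letters agree, the two gaps of generation `j` coincide; different letters would
put `x` on both sides of a gap of positive length. -/
lemma eq_of_mem_atom {j m n : ℕ} {a b : ℕ → Bool} {x : ℝ} (hxa : x ∈ P.atom m a)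
    (hxb : x ∈ P.atom n b) (hm : j < m) (hn : j < n) : a j = b j := by
  induction j using Nat.strong_induction_on with
  | _ j ih =>
    have hc : P.centre j a = P.centre j b :=
      P.centre_congr fun i hi => ih i hi (by omega) (by omega)
    have hg := P.gapRad_pos j
    cases ha : a j <;> cases hb : b j <;> try rfl
    · have h1 := P.le_of_mem_atom_of_false hxa hm ha
      have h2 := P.le_of_mem_atom_of_true hxb hn hb
      linarith
    · have h1 := P.le_of_mem_atom_of_true hxa hm ha
      have h2 := P.le_of_mem_atom_of_false hxb hn hb
      linarith

lemma point_injective : Function.Injective P.point := fun a b h => funext fun j =>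
  P.eq_of_mem_atom (P.point_mem_atom (j + 1) a) (h ▸ P.point_mem_atom (j + 1) b)
    (Nat.lt_succ_self j) (Nat.lt_succ_self j)

lemma point_notMem_gap (n : ℕ) (a b : ℕ → Bool) : P.point a ∉ P.gap n b := by
  intro h
  have hc : P.centre n a = P.centre n b := P.centre_congr fun j hj =>
    P.eq_of_mem_atom (P.point_mem_atom n a) (P.gap_subset_atom n b h) hj hj
  have hx := P.point_mem_atom (n + 1) a
  cases ha : a n
  · have := P.le_of_mem_atom_of_false hx (Nat.lt_succ_self n) ha
    linarith [h.1]
  · have := P.le_of_mem_atom_of_true hx (Nat.lt_succ_self n) ha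
    linarith [h.2]

lemma eq_point_of_forall_mem_atom {x : ℝ} {a : ℕ → Bool} (h : ∀ n, x ∈ P.atom n a) :
    x = P.point a := by
  refine tendsto_nhds_unique (tendsto_const_nhds) (tendsto_order.2 ⟨?_, ?_⟩ : Tendsto
    (fun _ : ℕ => x) atTop (𝓝 (P.point a)))
  · intro y hy
    have := ((P.tendsto_centre a).sub P.tendsto_atomRad).eventually_const_lt (u := y) (by simpa)
    exact this.mono fun n hn => hn.trans_le (h n).1
  · intro y hy
    have := ((P.tendsto_centre a).add P.tendsto_atomRad).eventually_lt_const (u := y) (by simpa)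
    exact this.mono fun n hn => (h n).2.trans_lt hn

lemma cantor_eq_range : P.cantor = range P.point := by
  apply Subset.antisymm
  · intro x hx
    have hx' : ∀ n, ∃ a, x ∈ P.atom n a := by simpa [cantor] using hx
    have hcl : ∀ n, IsClosed {a | x ∈ P.atom n a} := fun n =>
      (isClosed_le ((P.continuous_centre n).sub continuous_const) continuous_const).inter
        (isClosed_le continuous_const ((P.continuous_centre n).add continuous_const))
    -- The word may depend on the generation; compactness of the space of itineraries supplies one
    -- word valid for all generations.
    obtain ⟨a, ha⟩ := IsCompact.nonempty_iInter_of_sequence_nonempty_isCompact_isClosed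
      (fun n => {a | x ∈ P.atom n a}) (fun n a ha => P.atom_succ_subset n a ha) hx'
      (hcl 0).isCompact hcl
    exact ⟨a, (P.eq_point_of_forall_mem_atom fun n => (mem_iInter.1 ha n :)).symm⟩
  · rintro _ ⟨a, rfl⟩
    exact mem_iInter.2 fun n => mem_iUnion.2 ⟨a, P.point_mem_atom n a⟩

lemma cantor_subset_interval : P.cantor ⊆ P.interval := by
  rw [cantor_eq_range]
  rintro _ ⟨a, rfl⟩
  exact P.point_mem_atom 0 a

lemma atom_one_subset_dom (a : ℕ → Bool) : P.atom 1 a ⊆ P.dom := by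
  intro x hx
  have h0 : x ∈ Icc (P.mid - P.rad) (P.mid + P.rad) := P.atom_subset_interval 1 a hx
  cases ha : a 0
  · exact Or.inl ⟨h0.1, P.le_of_mem_atom_of_false hx one_pos ha⟩
  · exact Or.inr ⟨P.le_of_mem_atom_of_true hx one_pos ha, h0.2⟩

lemma point_mem_dom (a : ℕ → Bool) : P.point a ∈ P.dom :=
  P.atom_one_subset_dom a (P.point_mem_atom 1 a)

/-- A Bowen map acts on the Cantor set as the shift. -/
lemma _root_.IsBowenMap.apply_point {P : BowenParam} {G : ℝ → ℝ} (hG : IsBowenMap P G)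
    (a : ℕ → Bool) : G (P.point a) = P.point (shiftSeq a) := by
  -- The gap centres approximate the Cantor point from within the domain of continuity, and their
  -- images lie in gaps that shrink to the shifted point.
  have h1 : Tendsto (fun n => P.centre (n + 1) a) atTop (𝓝[P.dom] (P.point a)) :=
    tendsto_nhdsWithin_iff.2 ⟨(tendsto_add_atTop_iff_nat 1).2 (P.tendsto_centre a),
      Eventually.of_forall fun n => P.atom_one_subset_dom a (P.centre_mem_atom (by omega) a)⟩
  have h2 := (hG.continuousOn _ (P.point_mem_dom a)).tendsto.comp h1
  have h3 : ∀ n, G (P.centre (n + 1) a) ∈ P.gap n (shiftSeq a) := fun n =>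
    hG.image_gap n a ▸ mem_image_of_mem G (P.centre_mem_gap (n + 1) a)
  refine tendsto_nhds_unique h2 ?_
  refine tendsto_of_tendsto_of_tendsto_of_le_of_le
    (g := fun n => P.centre n (shiftSeq a) - P.gapRad n)
    (h := fun n => P.centre n (shiftSeq a) + P.gapRad n) ?_ ?_
    (fun n => (h3 n).1.le) (fun n => (h3 n).2.le)
  · simpa using (P.tendsto_centre (shiftSeq a)).sub P.tendsto_gapRad
  · simpa using (P.tendsto_centre (shiftSeq a)).add P.tendsto_gapRad

/-- The two end points matter because they are glued together on the circle. -/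
lemma point_const_false : P.point (fun _ => false) = P.mid - P.rad := by
  refine (P.eq_point_of_forall_mem_atom fun n => ?_).symm
  have h : P.centre n (fun _ => false) - P.atomRad n = P.mid - P.rad := by
    induction n with
    | zero => rfl
    | succ n ih =>
      rw [centre_succ, offset_eq, boolSign_false]; linarith
  have := P.atomRad_pos n
  exact ⟨h.le, by linarith⟩

lemma point_const_true : P.point (fun _ => true) = P.mid + P.rad := by
  refine (P.eq_point_of_forall_mem_atom fun n => ?_).symm
  have h : P.centre n (fun _ => true) + P.atomRad n = P.mid + P.rad := by
    induction n with
    | zero => rfl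
    | succ n ih =>
      rw [centre_succ, offset_eq, boolSign_true]; linarith
  have := P.atomRad_pos n
  exact ⟨by linarith, h.ge⟩

/-! ### Positive length of the Cantor set. -/

lemma mem_atom_succ_or_mem_gap {n : ℕ} {a : ℕ → Bool} {x : ℝ} (hx : x ∈ P.atom n a) :
    x ∈ P.gap n a ∨ ∃ b, x ∈ P.atom (n + 1) b := by
  by_cases h : x ∈ P.gap n a
  · exact Or.inl h
  right
  have key : ∀ s : Bool, P.centre (n + 1) (Function.update a n s) =
      P.centre n a + boolSign s * P.offset n := fun s => by
    rw [centre_succ, Function.update_self]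
    congr 1
    exact P.centre_congr fun j hj => Function.update_of_ne hj.ne _ _
  have ho := P.offset_eq n
  have ho' : P.offset n = P.gapRad n + P.atomRad (n + 1) := rfl
  rcases le_or_gt x (P.centre n a - P.gapRad n) with h1 | h1
  · refine ⟨Function.update a n false, ?_⟩
    rw [atom, key, boolSign_false]
    exact ⟨by linarith [hx.1], by linarith⟩
  · have h2 : P.centre n a + P.gapRad n ≤ x := not_lt.1 fun h2 => h ⟨h1, h2⟩
    refine ⟨Function.update a n true, ?_⟩
    rw [atom, key, boolSign_true]
    exact ⟨by linarith, by linarith [hx.2]⟩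

/-- The extension of a finite word by `false`. -/
def extendWord {n : ℕ} (w : Fin n → Bool) : ℕ → Bool := fun j =>
  if h : j < n then w ⟨j, h⟩ else false

lemma gap_congr {n : ℕ} {a b : ℕ → Bool} (h : ∀ j < n, a j = b j) : P.gap n a = P.gap n b := by
  rw [gap, gap, P.centre_congr h]

lemma interval_subset_cantor_union_gaps :
    P.interval ⊆ P.cantor ∪ ⋃ n, ⋃ w : Fin n → Bool, P.gap n (extendWord w) := by
  intro x hx
  by_contra hcon
  rw [mem_union, not_or] at hcon
  have hgap : ∀ n a, x ∉ P.gap n a := fun n a h => hcon.2 <| mem_iUnion₂.2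
    ⟨n, fun j => a j, by
      rwa [P.gap_congr (b := a)]
      intro j hj
      simp [extendWord, hj]⟩
  refine hcon.1 (mem_iInter.2 fun n => mem_iUnion.2 ?_)
  induction n with
  | zero => exact ⟨fun _ => false, hx⟩
  | succ n ih =>
    obtain ⟨a, ha⟩ := ih
    exact (P.mem_atom_succ_or_mem_gap ha).resolve_left (hgap n a)

lemma volume_gaps_le (n : ℕ) : volume (⋃ w : Fin n → Bool, P.gap n (extendWord w)) ≤
    ENNReal.ofReal (2 ^ n * (2 * P.gapRad n)) := by
  calc volume (⋃ w : Fin n → Bool, P.gap n (extendWord w))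
      ≤ ∑ w : Fin n → Bool, volume (P.gap n (extendWord w)) := measure_iUnion_fintype_le _ _
    _ = ∑ _w : Fin n → Bool, ENNReal.ofReal (2 * P.gapRad n) := by
        refine Finset.sum_congr rfl fun w _ => ?_
        rw [gap, Real.volume_Ioo]
        congr 1; ring
    _ = ENNReal.ofReal (2 ^ n * (2 * P.gapRad n)) := by
        have h : ENNReal.ofReal (2 ^ n) = 2 ^ n := by
          rw [ENNReal.ofReal_pow (by norm_num), ENNReal.ofReal_ofNat]
        rw [ENNReal.ofReal_mul (p := 2 ^ n) (by positivity), h]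
        simp

lemma hasSum_gap_lengths :
    HasSum (fun n => 2 ^ n * (2 * P.gapRad n)) (2 * P.b + ∑' n, P.α (n + 1)) := by
  have h : HasSum (fun n => 2 ^ (n + 1) * (2 * P.gapRad (n + 1))) (∑' n, P.α (n + 1)) := by
    convert P.α_summable.hasSum using 2 with n
    simp only [gapRad]; field_simp
  exact (hasSum_nat_add_iff' (f := fun n => 2 ^ n * (2 * P.gapRad n)) 1).1
    (by simpa [gapRad] using h)

/-- The gaps have total length at most `2b + ∑ α`, which is less than the length `2 rad` of the
interval. -/
lemma volume_cantor_pos : 0 < volume P.cantor := by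
  refine pos_iff_ne_zero.2 fun h0 => ?_
  have hs := P.hasSum_gap_lengths
  have h1 : volume P.interval ≤ ENNReal.ofReal (2 * P.b + ∑' n, P.α (n + 1)) :=
    calc volume P.interval
        ≤ volume P.cantor + volume (⋃ n, ⋃ w : Fin n → Bool, P.gap n (extendWord w)) :=
          (measure_mono P.interval_subset_cantor_union_gaps).trans (measure_union_le _ _)
      _ ≤ ∑' n, volume (⋃ w : Fin n → Bool, P.gap n (extendWord w)) := by
          rw [h0, zero_add]; exact measure_iUnion_le _
      _ ≤ ∑' n, ENNReal.ofReal (2 ^ n * (2 * P.gapRad n)) :=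
          ENNReal.tsum_le_tsum P.volume_gaps_le
      _ = ENNReal.ofReal (2 * P.b + ∑' n, P.α (n + 1)) := by
          rw [← hs.tsum_eq, ENNReal.ofReal_tsum_of_nonneg _ hs.summable]
          intro n
          have := P.gapRad_pos n
          positivity
  rw [interval, Real.volume_Icc] at h1
  have h2 := P.b_lt_rad
  have h3 := P.b_pos
  have h4 := P.α_tsum_lt
  rw [ENNReal.ofReal_le_ofReal_iff'] at h1
  rcases h1 with h1 | h1 <;> linarith

lemma volume_cantor_ne_top : volume P.cantor ≠ ⊤ :=
  ((measure_mono P.cantor_subset_interval).trans_lt (by simp [interval])).ne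

end BowenParam

/-! ### Flips of a single letter. -/

/-- The sequence `a` with its `s`-th term negated. -/
def flipAt (s : ℕ) (a : ℕ → Bool) : ℕ → Bool := Function.update a s (!a s)

lemma flipAt_self (s : ℕ) (a : ℕ → Bool) : flipAt s a s = !a s := Function.update_self ..

lemma flipAt_of_ne {s j : ℕ} (h : j ≠ s) (a : ℕ → Bool) : flipAt s a j = a j :=
  Function.update_of_ne h ..

lemma flipAt_flipAt (s : ℕ) (a : ℕ → Bool) : flipAt s (flipAt s a) = a := by
  funext j
  by_cases h : j = s
  · subst h; simp [flipAt_self]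
  · simp [flipAt_of_ne h]

lemma measurable_flipAt (s : ℕ) : Measurable (flipAt s) := by
  refine measurable_pi_lambda _ fun j => ?_
  by_cases h : j = s
  · subst h
    simp only [flipAt_self]
    exact (measurable_of_countable not).comp (measurable_pi_apply j)
  · simp only [flipAt_of_ne h]
    exact measurable_pi_apply j

/-! ### Walsh functions -/

/-- The Walsh function of the finite set `S`: the product of the signs of the terms in `S`. -/
def walsh (S : Finset ℕ) : C(ℕ → Bool, ℝ) where
  toFun a := ∏ s ∈ S, boolSign (a s)
  continuous_toFun := continuous_finsetProd _ fun j _ => BowenParam.continuous_boolSign_apply j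

lemma walsh_apply (S : Finset ℕ) (a : ℕ → Bool) : walsh S a = ∏ s ∈ S, boolSign (a s) := rfl

lemma walsh_empty : walsh ∅ = 1 := by ext a; simp [walsh_apply]

lemma walsh_mul_self_apply (S : Finset ℕ) (a : ℕ → Bool) : walsh S a * walsh S a = 1 := by
  simp [walsh_apply, ← Finset.prod_mul_distrib, boolSign_mul_self]

/-- Signs indexed by `S ∩ T` occur twice and square to `1`. -/
lemma walsh_mul_apply (S T : Finset ℕ) (a : ℕ → Bool) :
    walsh S a * walsh T a = walsh (symmDiff S T) a := by
  have hS : walsh S a = walsh (S ∩ T) a * walsh (S \ T) a :=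
    (Finset.prod_inter_mul_prod_sdiff S T _).symm
  have hT : walsh T a = walsh (S ∩ T) a * walsh (T \ S) a := by
    rw [Finset.inter_comm]
    exact (Finset.prod_inter_mul_prod_sdiff T S _).symm
  have hU : walsh (symmDiff S T) a = walsh (S \ T) a * walsh (T \ S) a :=
    Finset.prod_union disjoint_sdiff_sdiff
  have := walsh_mul_self_apply (S ∩ T) a
  rw [hS, hT, hU]
  linear_combination (walsh (S \ T) a * walsh (T \ S) a) * this

lemma iterate_shiftSeq_apply (j : ℕ) (a : ℕ → Bool) (n : ℕ) : shiftSeq^[j] a n = a (n + j) := by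
  induction j generalizing n with
  | zero => rfl
  | succ j ih => rw [Function.iterate_succ_apply', shiftSeq, ih]; congr 1; omega

lemma walsh_iterate_shiftSeq (S : Finset ℕ) (j : ℕ) (a : ℕ → Bool) :
    walsh S (shiftSeq^[j] a) = walsh (S.map (addRightEmbedding j)) a := by
  simp [walsh_apply, iterate_shiftSeq_apply]

lemma walsh_flipAt {S : Finset ℕ} {s : ℕ} (hs : s ∈ S) (a : ℕ → Bool) :
    walsh S (flipAt s a) = -walsh S a := by
  rw [walsh_apply, walsh_apply, ← Finset.mul_prod_erase S _ hs, ← Finset.mul_prod_erase S _ hs,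
    flipAt_self, boolSign_not, neg_mul]
  congr 2
  exact Finset.prod_congr rfl fun j hj => by rw [flipAt_of_ne (Finset.ne_of_mem_erase hj)]

/-- Flipping a letter in `S` preserves the measure and negates the integrand. -/
lemma integral_walsh_eq_zero {ν : Measure (ℕ → Bool)}
    (hν : ∀ s, MeasurePreserving (flipAt s) ν ν) {S : Finset ℕ} (hS : S.Nonempty) :
    ∫ a, walsh S a ∂ν = 0 := by
  obtain ⟨s, hs⟩ := hS
  have h1 : ∫ a, walsh S (flipAt s a) ∂ν = ∫ a, walsh S a ∂ν := by
    conv_rhs => rw [← (hν s).map_eq]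
    exact (integral_map (measurable_flipAt s).aemeasurable
      (walsh S).continuous.aestronglyMeasurable).symm
  simp only [walsh_flipAt hs, integral_neg] at h1
  linarith

lemma map_addRightEmbedding_ne {S : Finset ℕ} (hS : S.Nonempty) {j k : ℕ} (h : j ≠ k) :
    S.map (addRightEmbedding j) ≠ S.map (addRightEmbedding k) := by
  intro he
  -- Translation by `j` raises the sum of the elements by `j` times the cardinality, so this sum
  -- tells the translates apart.
  have := congrArg (fun T : Finset ℕ => ∑ t ∈ T, t) he
  simp [Finset.sum_add_distrib, hS.ne_empty] at this
  exact h this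

/-! ### Sequences of uncorrelated random signs -/

section Signs

variable {Ω : Type*} [MeasurableSpace Ω] {μ : Measure Ω} [IsProbabilityMeasure μ]

lemma integrable_of_sign {f : Ω → ℝ} (hf : Measurable f) (h : ∀ ω, f ω * f ω = 1) :
    Integrable f μ :=
  Integrable.of_bound hf.aestronglyMeasurable 1 (Eventually.of_forall fun ω => by
    rcases mul_self_eq_one_iff.1 (h ω) with h | h <;> simp [h])

/-- Every function on `{1, -1}` is affine. So the law of a sign is determined by its mean, and the
joint law of two signs by their means and the mean of their product. -/
lemma indicator_one_of_sign (A : Set ℝ) {x : ℝ} (h : x * x = 1) :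
    A.indicator 1 x = (A.indicator 1 1 + A.indicator 1 (-1)) / 2 +
      (A.indicator 1 1 - A.indicator 1 (-1)) / 2 * x := by
  rcases mul_self_eq_one_iff.1 h with rfl | rfl <;> ring

lemma measureReal_preimage_of_sign {f : Ω → ℝ} (hf : Measurable f) (h : ∀ ω, f ω * f ω = 1)
    (hf0 : ∫ ω, f ω ∂μ = 0) {A : Set ℝ} (hA : MeasurableSet A) :
    μ.real (f ⁻¹' A) = (A.indicator 1 1 + A.indicator 1 (-1)) / 2 := by
  have hi := integrable_of_sign (μ := μ) hf h
  rw [← integral_indicator_one (hf hA)]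
  have : (f ⁻¹' A).indicator 1 = fun ω => (A.indicator 1 1 + A.indicator 1 (-1)) / 2 +
      (A.indicator 1 1 - A.indicator 1 (-1)) / 2 * f ω :=
    funext fun ω => indicator_one_of_sign A (h ω)
  rw [this, integral_add (integrable_const _) (hi.const_mul _), integral_const_mul, hf0]
  simp

/-- Indicators of events of `f` and of `g` are affine in `f` and `g`; in the product of two of them
only the constant term survives integration. -/
lemma indepFun_of_sign {f g : Ω → ℝ} (hf : Measurable f) (hg : Measurable g)
    (hf1 : ∀ ω, f ω * f ω = 1) (hg1 : ∀ ω, g ω * g ω = 1) (hf0 : ∫ ω, f ω ∂μ = 0)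
    (hg0 : ∫ ω, g ω ∂μ = 0) (hfg : ∫ ω, f ω * g ω ∂μ = 0) :
    ProbabilityTheory.IndepFun f g μ := by
  rw [ProbabilityTheory.indepFun_iff_measure_inter_preimage_eq_mul]
  intro A B hA hB
  rw [← ENNReal.toReal_eq_toReal_iff' (by simp) (by finiteness), ENNReal.toReal_mul]
  change μ.real _ = μ.real _ * μ.real _
  rw [measureReal_preimage_of_sign hf hf1 hf0 hA, measureReal_preimage_of_sign hg hg1 hg0 hB,
    ← integral_indicator_one ((hf hA).inter (hg hB))]
  set p : ℝ := (A.indicator 1 1 + A.indicator 1 (-1)) / 2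
  set q : ℝ := (A.indicator 1 1 - A.indicator 1 (-1)) / 2
  set r : ℝ := (B.indicator 1 1 + B.indicator 1 (-1)) / 2
  set t : ℝ := (B.indicator 1 1 - B.indicator 1 (-1)) / 2
  have : (f ⁻¹' A ∩ g ⁻¹' B).indicator 1 =
      fun ω => p * r + (p * t * g ω + (q * r * f ω + q * t * (f ω * g ω))) := by
    funext ω
    rw [inter_indicator_one]
    change A.indicator (1 : ℝ → ℝ) (f ω) * B.indicator (1 : ℝ → ℝ) (g ω) = _
    rw [indicator_one_of_sign A (hf1 ω), indicator_one_of_sign B (hg1 ω)]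
    ring
  have hfg1 : ∀ ω, f ω * g ω * (f ω * g ω) = 1 := fun ω => by
    linear_combination (g ω * g ω) * hf1 ω + hg1 ω
  have i1 : Integrable (fun ω => p * t * g ω) μ := (integrable_of_sign hg hg1).const_mul _
  have i2 : Integrable (fun ω => q * r * f ω) μ := (integrable_of_sign hf hf1).const_mul _
  have i3 : Integrable (fun ω => q * t * (f ω * g ω)) μ :=
    (integrable_of_sign (hf.mul hg) hfg1).const_mul _
  have i23 : Integrable (fun ω => q * r * f ω + q * t * (f ω * g ω)) μ := i2.add i3
  have i123 : Integrable (fun ω => p * t * g ω + (q * r * f ω + q * t * (f ω * g ω))) μ :=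
    i1.add i23
  rw [this, integral_add (integrable_const _) i123, integral_add i1 i23, integral_add i2 i3,
    integral_const, integral_const_mul, integral_const_mul, integral_const_mul, hf0, hg0, hfg]
  simp

lemma identDistrib_of_sign {f g : Ω → ℝ} (hf : Measurable f) (hg : Measurable g)
    (hf1 : ∀ ω, f ω * f ω = 1) (hg1 : ∀ ω, g ω * g ω = 1) (hf0 : ∫ ω, f ω ∂μ = 0)
    (hg0 : ∫ ω, g ω ∂μ = 0) : ProbabilityTheory.IdentDistrib f g μ μ where
  aemeasurable_fst := hf.aemeasurable
  aemeasurable_snd := hg.aemeasurable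
  map_eq := by
    ext A hA
    rw [Measure.map_apply hf hA, Measure.map_apply hg hA,
      ← ENNReal.toReal_eq_toReal_iff' (by simp) (by simp)]
    exact (measureReal_preimage_of_sign hf hf1 hf0 hA).trans
      (measureReal_preimage_of_sign hg hg1 hg0 hA).symm

/-- The strong law of large numbers for uncorrelated random signs. -/
lemma ae_tendsto_average_of_sign {X : ℕ → Ω → ℝ} (hm : ∀ j, Measurable (X j))
    (h1 : ∀ j ω, X j ω * X j ω = 1) (h0 : ∀ j, ∫ ω, X j ω ∂μ = 0)
    (hX : ∀ j k, j ≠ k → ∫ ω, X j ω * X k ω ∂μ = 0) :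
    ∀ᵐ ω ∂μ, Tendsto (fun n : ℕ => (∑ j ∈ Finset.range n, X j ω) / n) atTop (𝓝 0) := by
  -- This form of the strong law asks only for pairwise independence, which is all that vanishing
  -- correlations give.
  have := ProbabilityTheory.strong_law_ae_real X (integrable_of_sign (hm 0) (h1 0))
    (fun j k hjk => indepFun_of_sign (hm j) (hm k) (h1 j) (h1 k) (h0 j) (h0 k) (hX j k hjk))
    (fun j => identDistrib_of_sign (hm j) (hm 0) (h1 j) (h1 0) (h0 j) (h0 0))
  rwa [h0 0] at this

end Signs

/-! ### The product of two shifts -/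

/-- The shift on pairs of sequences. -/
def pairShift : (ℕ → Bool) × (ℕ → Bool) → (ℕ → Bool) × (ℕ → Bool) := Prod.map shiftSeq shiftSeq

lemma continuous_shiftSeq : Continuous shiftSeq :=
  continuous_pi fun n => continuous_apply (n + 1)

lemma continuous_pairShift : Continuous pairShift := continuous_shiftSeq.prodMap continuous_shiftSeq

/-- The product of two Walsh functions, as a function of a pair of sequences. -/
def pairWalsh (u : Finset ℕ × Finset ℕ) : C((ℕ → Bool) × (ℕ → Bool), ℝ) where
  toFun p := walsh u.1 p.1 * walsh u.2 p.2
  continuous_toFun := by fun_prop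

lemma pairWalsh_apply (u : Finset ℕ × Finset ℕ) (p : (ℕ → Bool) × (ℕ → Bool)) :
    pairWalsh u p = walsh u.1 p.1 * walsh u.2 p.2 := rfl

lemma pairWalsh_empty : pairWalsh (∅, ∅) = 1 := by
  ext p; simp [pairWalsh_apply, walsh_empty]

lemma pairWalsh_mul_self_apply (u : Finset ℕ × Finset ℕ) (p : (ℕ → Bool) × (ℕ → Bool)) :
    pairWalsh u p * pairWalsh u p = 1 := by
  have h1 := walsh_mul_self_apply u.1 p.1
  have h2 := walsh_mul_self_apply u.2 p.2
  rw [pairWalsh_apply]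
  linear_combination (walsh u.2 p.2 * walsh u.2 p.2) * h1 + h2

lemma pairWalsh_mul_apply (u v : Finset ℕ × Finset ℕ) (p : (ℕ → Bool) × (ℕ → Bool)) :
    pairWalsh u p * pairWalsh v p = pairWalsh (symmDiff u.1 v.1, symmDiff u.2 v.2) p := by
  simp only [pairWalsh_apply, ← walsh_mul_apply]; ring

lemma pairWalsh_iterate_pairShift (u : Finset ℕ × Finset ℕ) (j : ℕ)
    (p : (ℕ → Bool) × (ℕ → Bool)) : pairWalsh u (pairShift^[j] p) =
      pairWalsh (u.1.map (addRightEmbedding j), u.2.map (addRightEmbedding j)) p := by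
  simp [pairWalsh_apply, pairShift, Prod.map_iterate, walsh_iterate_shiftSeq]

/-- The span of the products of Walsh functions is dense. -/
lemma closure_span_pairWalsh :
    (Submodule.span ℝ (range pairWalsh)).topologicalClosure = ⊤ := by
  -- The Walsh products are closed under multiplication, so their span is already the algebra they
  -- generate and Stone-Weierstrass applies to it.
  let M : Submonoid C((ℕ → Bool) × (ℕ → Bool), ℝ) :=
    { carrier := range pairWalsh
      one_mem' := ⟨_, pairWalsh_empty⟩
      mul_mem' := by
        rintro _ _ ⟨u, rfl⟩ ⟨v, rfl⟩
        exact ⟨_, ContinuousMap.ext fun p => (pairWalsh_mul_apply u v p).symm⟩ }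
  have hM : Subalgebra.toSubmodule (Algebra.adjoin ℝ (range pairWalsh)) =
      Submodule.span ℝ (range pairWalsh) := by
    rw [Algebra.adjoin_eq_span]
    exact congrArg (fun N : Submonoid C((ℕ → Bool) × (ℕ → Bool), ℝ) =>
      Submodule.span ℝ (N : Set C((ℕ → Bool) × (ℕ → Bool), ℝ))) (Submonoid.closure_eq M)
  have hsep : (Algebra.adjoin ℝ (range pairWalsh)).SeparatesPoints := by
    intro p q hpq
    by_contra! hcon
    have hw : ∀ u, pairWalsh u p = pairWalsh u q := fun u =>
      hcon _ ⟨pairWalsh u, Algebra.subset_adjoin (mem_range_self u), rfl⟩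
    refine hpq (Prod.ext (funext fun j => ?_) (funext fun j => ?_))
    · simpa [pairWalsh_apply, walsh_apply, boolSign_injective.eq_iff] using hw ({j}, ∅)
    · simpa [pairWalsh_apply, walsh_apply, boolSign_injective.eq_iff] using hw (∅, {j})
  have h := ContinuousMap.subalgebra_topologicalClosure_eq_top_of_separatesPoints _ hsep
  rw [← hM]
  refine Submodule.eq_top_iff'.2 fun φ => ?_
  have : φ ∈ (Algebra.adjoin ℝ (range pairWalsh)).topologicalClosure := h ▸ Algebra.mem_top
  exact this

/-- If orbit averages at `p` converge to the expectations for all products of Walsh functions, then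
they do so for all continuous functions. -/
lemma tendsto_average_of_pairWalsh {ν : Measure ((ℕ → Bool) × (ℕ → Bool))}
    [IsProbabilityMeasure ν] {x : ℕ → (ℕ → Bool) × (ℕ → Bool)}
    (h : ∀ u, Tendsto (fun n : ℕ => (∑ j ∈ Finset.range n, pairWalsh u (x j)) / n) atTop
      (𝓝 (∫ p, pairWalsh u p ∂ν))) (φ : C((ℕ → Bool) × (ℕ → Bool), ℝ)) :
    Tendsto (fun n : ℕ => (∑ j ∈ Finset.range n, φ (x j)) / n) atTop (𝓝 (∫ p, φ p ∂ν)) := by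
  have hint : ∀ ψ : C((ℕ → Bool) × (ℕ → Bool), ℝ), Integrable ψ ν := fun ψ =>
    ψ.continuous.integrable_of_hasCompactSupport (HasCompactSupport.of_compactSpace _)
  have hspan : ∀ ψ ∈ Submodule.span ℝ (range pairWalsh),
      Tendsto (fun n : ℕ => (∑ j ∈ Finset.range n, ψ (x j)) / n) atTop (𝓝 (∫ p, ψ p ∂ν)) := by
    intro ψ hψ
    induction hψ using Submodule.span_induction with
    | mem ψ hψ =>
      obtain ⟨u, rfl⟩ := hψ
      exact h u
    | zero => simp
    | add ψ₁ ψ₂ _ _ h₁ h₂ =>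
      simp only [ContinuousMap.add_apply, Finset.sum_add_distrib, add_div]
      rw [integral_add (hint ψ₁) (hint ψ₂)]
      exact h₁.add h₂
    | smul c ψ _ hψ =>
      simp only [ContinuousMap.smul_apply, smul_eq_mul, ← Finset.mul_sum, mul_div_assoc]
      rw [integral_const_mul]
      exact hψ.const_mul c
  have hφ : φ ∈ (Submodule.span ℝ (range pairWalsh)).topologicalClosure :=
    closure_span_pairWalsh ▸ Submodule.mem_top
  refine Metric.tendsto_atTop.2 fun ε hε => ?_
  obtain ⟨ψ, hψ, hd⟩ := Metric.mem_closure_iff.1 hφ (ε / 3) (by positivity)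
  obtain ⟨N, hN⟩ := Metric.tendsto_atTop.1 (hspan ψ hψ) (ε / 3) (by positivity)
  have hle : ∀ p, ‖φ p - ψ p‖ ≤ dist φ ψ := fun p =>
    (dist_eq_norm (φ p) (ψ p)).ge.trans (ContinuousMap.dist_apply_le_dist p)
  refine ⟨max N 1, fun n hn => ?_⟩
  have hn0 : (0 : ℝ) < n := by exact_mod_cast (le_of_max_le_right hn : 1 ≤ n)
  have h1 : dist ((∑ j ∈ Finset.range n, φ (x j)) / n) ((∑ j ∈ Finset.range n, ψ (x j)) / n)
      ≤ dist φ ψ := by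
    rw [Real.dist_eq, ← sub_div, ← Finset.sum_sub_distrib, abs_div, abs_of_pos hn0,
      div_le_iff₀ hn0]
    refine (Finset.abs_sum_le_sum_abs _ _).trans ((Finset.sum_le_sum fun j _ => hle (x j)).trans ?_)
    simp [mul_comm]
  have h2 : dist (∫ p, ψ p ∂ν) (∫ p, φ p ∂ν) ≤ dist φ ψ := by
    rw [dist_comm, dist_eq_norm, ← integral_sub (hint φ) (hint ψ)]
    simpa using norm_integral_le_of_norm_le_const (μ := ν) (Eventually.of_forall hle)
  calc dist ((∑ j ∈ Finset.range n, φ (x j)) / n) (∫ p, φ p ∂ν)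
      ≤ dist ((∑ j ∈ Finset.range n, φ (x j)) / n) ((∑ j ∈ Finset.range n, ψ (x j)) / n) +
        dist ((∑ j ∈ Finset.range n, ψ (x j)) / n) (∫ p, ψ p ∂ν) +
        dist (∫ p, ψ p ∂ν) (∫ p, φ p ∂ν) := dist_triangle4 _ _ _ _
    _ < ε := by linarith [hN n (le_of_max_le_left hn)]

section PairMeasure

variable {ν₁ ν₂ : Measure (ℕ → Bool)} [IsProbabilityMeasure ν₁] [IsProbabilityMeasure ν₂]

lemma integral_pairWalsh_eq_zero (h₁ : ∀ s, MeasurePreserving (flipAt s) ν₁ ν₁)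
    (h₂ : ∀ s, MeasurePreserving (flipAt s) ν₂ ν₂) {u : Finset ℕ × Finset ℕ} (hu : u ≠ (∅, ∅)) :
    ∫ p, pairWalsh u p ∂ν₁.prod ν₂ = 0 := by
  simp only [pairWalsh_apply]
  rw [integral_prod_mul (fun a => walsh u.1 a) (fun a => walsh u.2 a)]
  rcases u.1.eq_empty_or_nonempty with hS | hS
  · have hT : u.2.Nonempty := Finset.nonempty_iff_ne_empty.2 fun hT => hu (Prod.ext hS hT)
    rw [integral_walsh_eq_zero h₂ hT, mul_zero]
  · rw [integral_walsh_eq_zero h₁ hS, zero_mul]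

/-- For measures invariant under all flips, almost every point is generic for the product of the
shifts. -/
theorem ae_tendsto_average (h₁ : ∀ s, MeasurePreserving (flipAt s) ν₁ ν₁)
    (h₂ : ∀ s, MeasurePreserving (flipAt s) ν₂ ν₂) :
    ∀ᵐ p ∂ν₁.prod ν₂, ∀ φ : C((ℕ → Bool) × (ℕ → Bool), ℝ),
      Tendsto (fun n : ℕ => (∑ j ∈ Finset.range n, φ (pairShift^[j] p)) / n) atTop
        (𝓝 (∫ p, φ p ∂ν₁.prod ν₂)) := by
  have key : ∀ᵐ p ∂ν₁.prod ν₂, ∀ u, Tendsto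
      (fun n : ℕ => (∑ j ∈ Finset.range n, pairWalsh u (pairShift^[j] p)) / n) atTop
        (𝓝 (∫ p, pairWalsh u p ∂ν₁.prod ν₂)) := by
    refine ae_all_iff.2 fun u => ?_
    by_cases hu : u = (∅, ∅)
    · subst hu
      refine Eventually.of_forall fun p => ?_
      simp only [pairWalsh_empty, ContinuousMap.one_apply, Finset.sum_const, Finset.card_range,
        nsmul_eq_mul, mul_one, integral_const, probReal_univ, smul_eq_mul]
      refine tendsto_const_nhds.congr' ((eventually_ge_atTop 1).mono fun n hn => ?_)
      exact (div_self (by positivity)).symm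
    -- The product of two distinct translates is again a nontrivial Walsh product, so its integral
    -- vanishes.
    have htrans : ∀ j k : ℕ, j ≠ k →
        (symmDiff (u.1.map (addRightEmbedding j)) (u.1.map (addRightEmbedding k)),
          symmDiff (u.2.map (addRightEmbedding j)) (u.2.map (addRightEmbedding k))) ≠
            ((∅ : Finset ℕ), (∅ : Finset ℕ)) := by
      intro j k hjk he
      rw [Prod.mk.injEq, ← Finset.bot_eq_empty, symmDiff_eq_bot, symmDiff_eq_bot] at he
      rcases u.1.eq_empty_or_nonempty with hS | hS
      · have hT : u.2.Nonempty := Finset.nonempty_iff_ne_empty.2 fun hT => hu (Prod.ext hS hT)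
        exact map_addRightEmbedding_ne hT hjk he.2
      · exact map_addRightEmbedding_ne hS hjk he.1
    rw [integral_pairWalsh_eq_zero h₁ h₂ hu]
    simp only [pairWalsh_iterate_pairShift]
    refine ae_tendsto_average_of_sign (fun j => (pairWalsh _).continuous.measurable)
      (fun j p => pairWalsh_mul_self_apply _ p) (fun j => integral_pairWalsh_eq_zero h₁ h₂ ?_)
      (fun j k hjk => ?_)
    · intro he
      rw [Prod.mk.injEq, Finset.map_eq_empty, Finset.map_eq_empty] at he
      exact hu (Prod.ext he.1 he.2)
    · simp only [pairWalsh_mul_apply]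
      exact integral_pairWalsh_eq_zero h₁ h₂ (htrans j k hjk)
  exact key.mono fun p hp φ => tendsto_average_of_pairWalsh hp φ

/-- Along the orbit of one generic point, the averages of `φ ∘ pairShift` and of `φ` differ by a
telescoping term of order `1 / n`, so the two integrals agree. -/
theorem measurePreserving_pairShift (h₁ : ∀ s, MeasurePreserving (flipAt s) ν₁ ν₁)
    (h₂ : ∀ s, MeasurePreserving (flipAt s) ν₂ ν₂) :
    MeasurePreserving pairShift (ν₁.prod ν₂) (ν₁.prod ν₂) := by
  have hm := continuous_pairShift.measurable
  refine ⟨hm, ?_⟩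
  have := Measure.isProbabilityMeasure_map (μ := ν₁.prod ν₂) hm.aemeasurable
  refine ext_of_forall_integral_eq_of_IsFiniteMeasure fun φ => ?_
  rw [integral_map hm.aemeasurable φ.continuous.aestronglyMeasurable]
  obtain ⟨p, hp⟩ := (ae_tendsto_average h₁ h₂).exists
  let ψ : C((ℕ → Bool) × (ℕ → Bool), ℝ) :=
    ⟨fun p => φ (pairShift p), φ.continuous.comp continuous_pairShift⟩
  have hd := (hp ψ).sub (hp φ.toContinuousMap)
  have hz : Tendsto (fun n : ℕ => (φ (pairShift^[n] p) - φ p) / n) atTop (𝓝 0) := by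
    refine squeeze_zero_norm (a := fun n : ℕ => (2 * ‖φ‖) / n) (fun n => ?_)
      (tendsto_const_div_atTop_nhds_zero_nat _)
    rw [norm_div, RCLike.norm_natCast]
    gcongr
    rw [← dist_eq_norm]
    exact φ.dist_le_two_norm _ _
  have he := tendsto_nhds_unique (hd.congr fun n => ?_) hz
  · exact sub_eq_zero.1 he
  · rw [← sub_div, ← Finset.sum_sub_distrib]
    congr 1
    have := Finset.sum_range_sub (fun j => φ (pairShift^[j] p)) n
    simp only [Function.iterate_succ_apply'] at this
    exact this

end PairMeasure

/-! ### Lebesgue measure on the Cantor set in terms of itineraries. -/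

namespace BowenParam

variable (P : BowenParam)

lemma measurableEmbedding_point : MeasurableEmbedding P.point :=
  (P.continuous_point.isClosedEmbedding P.point_injective).measurableEmbedding

lemma isCompact_cantor : IsCompact P.cantor :=
  P.cantor_eq_range ▸ isCompact_range P.continuous_point

lemma point_flipAt (s : ℕ) (a : ℕ → Bool) :
    P.point (flipAt s a) = P.point a + -2 * boolSign (a s) * P.offset s := by
  have h := (P.summable_boolSign_mul_offset (flipAt s a)).tsum_sub
    (P.summable_boolSign_mul_offset a)
  rw [tsum_eq_single s fun j hj => by rw [flipAt_of_ne hj, sub_self], flipAt_self,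
    boolSign_not] at h
  simp only [point]
  linarith

/-- With the `s`-th letter fixed, the flip moves all coded points by the same amount, and Lebesgue
measure is translation invariant. -/
lemma comap_point_flipAt_image {s : ℕ} {b : Bool} {A : Set (ℕ → Bool)} (hA : ∀ a ∈ A, a s = b) :
    volume.comap P.point (flipAt s '' A) = volume.comap P.point A := by
  rw [P.measurableEmbedding_point.comap_apply, P.measurableEmbedding_point.comap_apply]
  have : P.point '' (flipAt s '' A) =
      (fun x => x + -2 * boolSign b * P.offset s) '' (P.point '' A) := by
    rw [image_image, image_image]
    exact image_congr fun a ha => by rw [point_flipAt, hA a ha]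
  rw [this, image_add_right, measure_preimage_add_right]

/-- The normalized Lebesgue measure of the Cantor set, transported to the space of itineraries. -/
def codeMeasure : Measure (ℕ → Bool) := (volume P.cantor)⁻¹ • volume.comap P.point

lemma measurePreserving_flipAt (s : ℕ) :
    MeasurePreserving (flipAt s) P.codeMeasure P.codeMeasure := by
  have hinv : Function.LeftInverse (flipAt s) (flipAt s) := flipAt_flipAt s
  have himg : ∀ A, flipAt s '' A = flipAt s ⁻¹' A := fun A =>
    congrFun (image_eq_preimage_of_inverse hinv hinv) A
  have hT : MeasurableSet {a : ℕ → Bool | a s = true} :=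
    (measurable_pi_apply s : Measurable fun a : ℕ → Bool => a s) (measurableSet_singleton true)
  refine MeasurePreserving.smul_measure ⟨measurable_flipAt s, ?_⟩ _
  ext A hA
  -- Preimages under an involution are images; splitting by the `s`-th letter leaves two pieces,
  -- each moved by a translation.
  rw [Measure.map_apply (measurable_flipAt s) hA, ← himg,
    ← measure_inter_add_sdiff A hT,
    ← measure_inter_add_sdiff (flipAt s '' A)
      ((himg _).symm ▸ measurable_flipAt s hT : MeasurableSet (flipAt s '' {a | a s = true})),
    ← image_inter hinv.injective, ← image_sdiff hinv.injective,
    P.comap_point_flipAt_image (b := true) fun a ha => ha.2,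
    P.comap_point_flipAt_image (b := false) fun a ha => by simpa using ha.2]

lemma map_point_codeMeasure :
    P.codeMeasure.map P.point = ProbabilityTheory.cond volume P.cantor := by
  rw [codeMeasure, Measure.map_smul, P.measurableEmbedding_point.map_comap, ← cantor_eq_range]
  rfl

instance : IsProbabilityMeasure P.codeMeasure := by
  refine ⟨?_⟩
  rw [codeMeasure, Measure.smul_apply, P.measurableEmbedding_point.comap_apply, image_univ,
    ← cantor_eq_range, smul_eq_mul,
    ENNReal.inv_mul_cancel P.volume_cantor_pos.ne' P.volume_cantor_ne_top]

/-- The image in the circle of the point of the Cantor set with the given itinerary. -/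
def circlePoint (a : ℕ → Bool) : S1 := (P.point a : S1)

lemma continuous_circlePoint : Continuous P.circlePoint :=
  (AddCircle.continuous_mk' 2).comp P.continuous_point

/-- The projection to the circle identifies only `-1` and `1` on `[-1, 1]`, and these two points are
null. -/
lemma restrict_circle_cantor (h : P.interval ⊆ Icc (-1) 1) :
    (volume : Measure S1).restrict ((fun x : ℝ => (x : S1)) '' P.cantor) =
      (volume.restrict P.cantor).map fun x : ℝ => (x : S1) := by
  have hmk : Measurable fun x : ℝ => (x : S1) := (AddCircle.continuous_mk' 2).measurable
  have hC : MeasurableSet ((fun x : ℝ => (x : S1)) '' P.cantor) :=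
    (P.isCompact_cantor.image (AddCircle.continuous_mk' 2)).measurableSet
  have hvol : Measure.map (fun x : ℝ => (x : S1)) (volume.restrict (Ioc (-1) (-1 + 2))) = volume :=
    (AddCircle.measurePreserving_mk 2 (-1)).map_eq
  rw [← hvol, Measure.restrict_map hmk hC, Measure.restrict_restrict (hmk hC)]
  congr 1
  refine Measure.restrict_congr_set ?_
  filter_upwards [Measure.ae_ne volume (-1 : ℝ), Measure.ae_ne volume (1 : ℝ)] with x hx1 hx2
  refine propext ⟨?_, fun hx => ⟨mem_image_of_mem _ hx, ?_⟩⟩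
  · rintro ⟨⟨y, hy, hyx⟩, hx⟩
    change (y : S1) = (x : S1) at hyx
    have hyI := h (P.cantor_subset_interval hy)
    have hxI : x ∈ Ico (-1 : ℝ) (-1 + 2) :=
      ⟨hx.1.le, lt_of_le_of_ne hx.2 (by norm_num; exact hx2)⟩
    by_cases hy1 : y = 1
    · exfalso
      have h1 : ((-1 : ℝ) : S1) = (x : S1) := by
        rw [← hyx, hy1, ← AddCircle.coe_add_period 2 (-1 : ℝ)]
        norm_num
      exact hx1 ((AddCircle.coe_eq_coe_iff_of_mem_Ico (by norm_num) hxI).1 h1).symm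
    · have hyI' : y ∈ Ico (-1 : ℝ) (-1 + 2) :=
        ⟨hyI.1, lt_of_le_of_ne (by linarith [hyI.2]) (by norm_num; exact hy1)⟩
      exact (AddCircle.coe_eq_coe_iff_of_mem_Ico hyI' hxI).1 hyx ▸ hy
  · have hxI := h (P.cantor_subset_interval hx)
    exact ⟨lt_of_le_of_ne hxI.1 (Ne.symm hx1), by linarith [hxI.2]⟩

lemma normLeb_circle_cantor (h : P.interval ⊆ Icc (-1) 1) :
    normLeb ((fun x : ℝ => (x : S1)) '' P.cantor) = P.codeMeasure.map P.circlePoint := by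
  have hmk : Measurable fun x : ℝ => (x : S1) := (AddCircle.continuous_mk' 2).measurable
  have hr := P.restrict_circle_cantor h
  have hv : volume ((fun x : ℝ => (x : S1)) '' P.cantor) = volume P.cantor := by
    have := congrArg (fun μ : Measure S1 => μ univ) hr
    simpa [Measure.map_apply hmk] using this
  have hc : P.circlePoint = (fun x : ℝ => (x : S1)) ∘ P.point := rfl
  rw [hc, ← Measure.map_map hmk P.continuous_point.measurable, map_point_codeMeasure, normLeb,
    ProbabilityTheory.cond, ProbabilityTheory.cond, hr, hv, Measure.map_smul]

end BowenParam

/-! ### The maps of the circle -/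

namespace FirstExample

variable (E : FirstExample)

lemma interval_subset_Icc : E.P.interval ⊆ Icc (-1) 1 := by
  rw [BowenParam.interval, E.mid_eq, E.rad_eq, zero_sub, zero_add]

lemma intervalMap_point (a : ℕ → Bool) :
    E.intervalMap (E.P.point a) = E.P.point (shiftSeq a) := by
  have h : E.P.point a ∉ Ioo (-E.P.b) E.P.b := by
    have := E.P.point_notMem_gap 0 a a
    simpa [BowenParam.gap, BowenParam.centre, BowenParam.gapRad, E.mid_eq] using this
  rw [intervalMap, if_neg h, E.isBowenMap.apply_point]

/-- The map is read off on `[-1, 1)`, so the point `1` is handled through its other representative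
`-1`; their itineraries are constant, hence fixed by the shift. -/
lemma map_circlePoint (a : ℕ → Bool) :
    E.map (E.P.circlePoint a) = E.P.circlePoint (shiftSeq a) := by
  have key : ∀ a, E.P.point a ≠ 1 → E.map (E.P.circlePoint a) = E.P.circlePoint (shiftSeq a) := by
    intro a ha
    have hI := E.interval_subset_Icc (E.P.point_mem_atom 0 a)
    rw [map, BowenParam.circlePoint, AddCircle.liftIco_coe_apply
      ⟨hI.1, lt_of_le_of_ne (by linarith [hI.2]) (by norm_num; exact ha)⟩, intervalMap_point]
    rfl
  by_cases ha : E.P.point a = 1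
  · have h1 : E.P.point (fun _ => true) = 1 := by
      rw [E.P.point_const_true, E.mid_eq, E.rad_eq, zero_add]
    have h0 : E.P.point (fun _ => false) = -1 := by
      rw [E.P.point_const_false, E.mid_eq, E.rad_eq, zero_sub]
    have hc : E.P.circlePoint (fun _ => true) = E.P.circlePoint (fun _ => false) := by
      rw [BowenParam.circlePoint, BowenParam.circlePoint, h0, h1,
        ← AddCircle.coe_add_period 2 (-1 : ℝ)]
      norm_num
    obtain rfl := E.P.point_injective (ha.trans h1.symm)
    have := key (fun _ => false) (by rw [h0]; norm_num)
    rw [hc, this]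
    exact hc.symm
  · exact key a ha

/-- `G` and `Gc` are controlled only on their own domains, so they are first cut off to globally
measurable functions that give the same map on `[-1, 1)`. -/
lemma measurable_map : Measurable E.map := by
  classical
  have hdom : MeasurableSet E.P.dom := measurableSet_Icc.union measurableSet_Icc
  have h1 : Measurable (E.P.dom.piecewise E.G fun _ => 0) :=
    E.isBowenMap.continuousOn.measurable_piecewise continuousOn_const hdom
  have h2 : Measurable ((Ioo (-E.P.b) E.P.b).piecewise E.Gc fun _ => 0) :=
    (E.contDiffOn_Gc.continuousOn.mono Ioo_subset_Icc_self).measurable_piecewise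
      continuousOn_const measurableSet_Ioo
  have h3 : Measurable ((Ioo (-E.P.b) E.P.b).piecewise
      ((Ioo (-E.P.b) E.P.b).piecewise E.Gc fun _ => 0) (E.P.dom.piecewise E.G fun _ => 0)) :=
    h2.piecewise measurableSet_Ioo h1
  have h4 : (Ico (-1 : ℝ) (-1 + 2)).domRestrict (fun x => (E.intervalMap x : S1)) =
      (Ico (-1 : ℝ) (-1 + 2)).domRestrict fun x => ((Ioo (-E.P.b) E.P.b).piecewise
        ((Ioo (-E.P.b) E.P.b).piecewise E.Gc fun _ => 0)
        (E.P.dom.piecewise E.G fun _ => 0) x : S1) := by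
    refine domRestrict_eq_domRestrict_iff.2 fun x hx => ?_
    congr 1
    by_cases hb : x ∈ Ioo (-E.P.b) E.P.b
    · simp [intervalMap, hb, piecewise]
    · have hd : x ∈ E.P.dom := by
        rw [BowenParam.dom, E.mid_eq, E.rad_eq]
        rcases le_or_gt x (-E.P.b) with h | h
        · exact Or.inl ⟨by linarith [hx.1], by linarith⟩
        · exact Or.inr ⟨by linarith [not_lt.1 fun h' => hb ⟨h, h'⟩], by linarith [hx.2]⟩
      simp only [intervalMap, piecewise, if_neg hb, if_pos hd]
  have h5 : E.map = (Ico (-1 : ℝ) (-1 + 2)).domRestrict (fun x => (E.intervalMap x : S1)) ∘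
      AddCircle.measurableEquivIco 2 (-1) := rfl
  rw [h5, h4]
  exact (((AddCircle.continuous_mk' 2).measurable.comp h3).comp measurable_subtype_coe).comp
    (MeasurableEquiv.measurable _)

end FirstExample

lemma IsC1ExpandingCircleMap.continuous {f : S1 → S1} (hf : IsC1ExpandingCircleMap f) :
    Continuous f := by
  obtain ⟨F, hF, -, hfF⟩ := hf
  have hq : IsQuotientMap (QuotientAddGroup.mk : ℝ → S1) := QuotientAddGroup.isQuotientMap_mk _
  refine hq.continuous_iff.2 ?_
  exact ((AddCircle.continuous_mk' 2).comp hF.continuous).congr fun x => (hfF x).symm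

namespace SecondExample

variable {k : ℕ} (E : SecondExample k)

lemma interval_subset_Icc (i : Fin k) : (E.P i).interval ⊆ Icc (-1) 1 := by
  induction i using WellFoundedLT.induction with
  | _ i ih =>
    by_cases hi : (i : ℕ) = 0
    · rw [BowenParam.interval, E.mid_eq i hi, E.rad_eq i hi, zero_sub, zero_add]
    · obtain ⟨n, a, hna⟩ := E.hostGap_isGap i hi
      calc (E.P i).interval ⊆ E.hostGap i := E.interval_subset i hi
        _ = (E.P (E.hostIndex i)).gap n a := hna
        _ ⊆ (E.P (E.hostIndex i)).atom n a := BowenParam.gap_subset_atom _ n a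
        _ ⊆ (E.P (E.hostIndex i)).interval := BowenParam.atom_subset_interval _ n a
        _ ⊆ Icc (-1) 1 := ih _ (E.hostIndex_lt i hi)

lemma map_circlePoint (i : Fin k) (a : ℕ → Bool) :
    E.map ((E.P i).circlePoint a) = (E.P i).circlePoint (shiftSeq a) := by
  rw [BowenParam.circlePoint, E.map_eq i _ ((E.P i).point_mem_dom a), (E.isBowenMap i).apply_point]
  · rfl
  -- The exceptional set consists of gaps of this same Cantor set, which its points avoid.
  · rintro j hj rfl hmem
    obtain ⟨n, b, hnb⟩ := E.hostGap_isGap j hj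
    exact BowenParam.point_notMem_gap _ n a b (hnb ▸ hmem)

end SecondExample

/-! ### Empiric averages -/

lemma integral_empiricMeasure {M : Type*} [TopologicalSpace M] [MeasurableSpace M] [BorelSpace M]
    (f : M → M) (n : ℕ) (x : M) (φ : C(M, ℝ)) :
    ∫ y, φ y ∂(empiricMeasure f n x) = (∑ j ∈ Finset.range n, φ (f^[j] x)) / n := by
  have hm : StronglyMeasurable φ := φ.continuous.measurable.stronglyMeasurable
  rw [empiricMeasure, integral_smul_measure, integral_finsetSum_measure fun j _ =>
    integrable_dirac' hm (by simp)]
  simp only [integral_dirac' _ _ hm, ENNReal.toReal_inv, ENNReal.toReal_natCast, smul_eq_mul]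
  rw [div_eq_inv_mul]

end

/-! ### Transfer to the torus. -/

theorem mainTheorem9 (E₁ : FirstExample) (k : ℕ) (E₂ : SecondExample k) (i : Fin k) :
    IsPhysical (volume : Measure T2) (torusProductMap E₁ E₂) (torusProductMeasure E₁ E₂ i) := by
  set ν := E₁.P.codeMeasure.prod (E₂.P i).codeMeasure
  let q : (ℕ → Bool) × (ℕ → Bool) → T2 := Prod.map E₁.P.circlePoint (E₂.P i).circlePoint
  have hq : Continuous q := E₁.P.continuous_circlePoint.prodMap (E₂.P i).continuous_circlePoint
  have hμ : torusProductMeasure E₁ E₂ i = ν.map q := by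
    rw [torusProductMeasure, FirstExample.cantor, SecondExample.cantor,
      E₁.P.normLeb_circle_cantor E₁.interval_subset_Icc,
      (E₂.P i).normLeb_circle_cantor (E₂.interval_subset_Icc i),
      Measure.map_prod_map _ _ E₁.P.continuous_circlePoint.measurable
        (E₂.P i).continuous_circlePoint.measurable]
  have hconj : Function.Semiconj q pairShift (torusProductMap E₁ E₂) := fun p =>
    Prod.ext (E₁.map_circlePoint p.1).symm (E₂.map_circlePoint i p.2).symm
  have hf : Measurable (torusProductMap E₁ E₂) :=
    E₁.measurable_map.prodMap E₂.expanding.continuous.measurable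
  have hgen := ae_tendsto_average E₁.P.measurePreserving_flipAt (E₂.P i).measurePreserving_flipAt
  have hshift := measurePreserving_pairShift E₁.P.measurePreserving_flipAt
    (E₂.P i).measurePreserving_flipAt
  have hbasin : ∀ᵐ p ∂ν, q p ∈ statBasin (torusProductMap E₁ E₂) (torusProductMeasure E₁ E₂ i) := by
    refine hgen.mono fun p hp φ => ?_
    rw [hμ, integral_map hq.measurable.aemeasurable φ.continuous.aestronglyMeasurable]
    simp only [integral_empiricMeasure, ← (hconj.iterate_right _).eq]
    exact hp (φ.comp ⟨q, hq⟩)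
  refine ⟨hμ ▸ Measure.isProbabilityMeasure_map hq.measurable.aemeasurable, ⟨hf, ?_⟩, ?_⟩
  · rw [hμ, Measure.map_map hf hq.measurable, ← hconj.comp_eq,
      ← Measure.map_map hq.measurable hshift.measurable, hshift.map_eq]
  · refine pos_iff_ne_zero.2 fun h0 => ?_
    have hac : torusProductMeasure E₁ E₂ i ≪ volume :=
      ProbabilityTheory.cond_absolutelyContinuous.prod ProbabilityTheory.cond_absolutelyContinuous
    -- An inequality for the image measure suffices here, so measurability of the basin is not
    -- needed.
    have hnull : ν (q ⁻¹' statBasin (torusProductMap E₁ E₂) (torusProductMeasure E₁ E₂ i)) = 0 :=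
      nonpos_iff_eq_zero.1 <| (Measure.le_map_apply hq.measurable.aemeasurable _).trans_eq
        (hμ ▸ hac h0)
    obtain ⟨p, hp, hp'⟩ := (hbasin.and (measure_eq_zero_iff_ae_notMem.1 hnull)).exists
    exact hp' hp
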